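/- A directed graph $\Gamma=(V,E,s,r)$ consists of arbitrary sets $V$ (vertices) and $E$ (edges) and functions $s,r:E\to V$ (source and range). Its graph inverse semigroup $\mathrm{Inv}(\Gamma)$ is the semigroup with zero generated by $V\cup E\cup\{e^*: e\in E\}$ subject to the relations, for all $u,v\in V$ and $e,f\in E$, $$uv=\delta_{u,v}u,\qquad s(e)e=e\,r(e)=e,\qquad r(e)e^*=e^*s(e)=e^*,\qquad f^*e=\delta_{f,e}\,r(e).$$ For a semigroup $S$, let $\mathscr{C}(S)$ be the lattice of all congruences on $S$, ordered by inclusion. A lattice is distributive if $(a\vee b)\wedge c=(a\wedge c)\vee(b\wedge c)$ for all its elements $a,b,c$. A subgraph of $\Gamma$ is a directed graph $(V',E',s|_{E'},r|_{E'})$ with $V'\subseteq V$, $E'\subseteq E$ and $s(E')\cup r(E')\subseteq V'$. A directed graph is weakly connected if any two distinct vertices are joined by an undirected path, and a weakly connected component of $\Gamma$ is a weakly connected subgraph of $\Gamma$ that is maximal under inclusion. **Corollary.** Let $\Gamma$ be a directed graph and let $\{\Gamma_i\}_{i\in I}$ be the collection of all weakly connected components of $\Gamma$. Then $\mathscr{C}(\mathrm{Inv}(\Gamma))$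 is distributive if and only if $\mathscr{C}(\mathrm{Inv}(\Gamma_i))$ is distributive for every $i\in I$. -/

import Mathlib

universe u v

/-- A directed graph `(V, E, s, r)`; loops and parallel edges are allowed, and both sets may be
infinite. -/
structure DirectedGraph (V : Type u) (E : Type v) where
  /-- the source of an edge -/
  s : E → V
  /-- the range of an edge -/
  r : E → V

namespace DirectedGraph

variable {V : Type u} {E : Type v}

section GraphInverseSemigroup

/-- The generators of the graph inverse semigroup: the vertices `v`, the edges `e` and the
symbols `e*`. -/
inductive Gen (V : Type u) (E : Type v) : Type (max u v)
  | vertex (v : V) : Gen V E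
  | edge (e : E) : Gen V E
  | star (e : E) : Gen V E

/-- The free semigroup with zero on the generators. -/
abbrev FreeWithZero (V : Type u) (E : Type v) : Type (max u v) :=
  WithZero (FreeSemigroup (Gen V E))

/-- The vertex `v` in the free semigroup with zero. -/
def freeVertex (E : Type v) (v : V) : FreeWithZero V E :=
  WithZero.coe (FreeSemigroup.of (Gen.vertex v))

/-- The edge `e` in the free semigroup with zero. -/
def freeEdge (V : Type u) (e : E) : FreeWithZero V E :=
  WithZero.coe (FreeSemigroup.of (Gen.edge e))

/-- The symbol `e*` in the free semigroup with zero. -/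
def freeStar (V : Type u) (e : E) : FreeWithZero V E :=
  WithZero.coe (FreeSemigroup.of (Gen.star e))

/-- The defining relations of the graph inverse semigroup. -/
inductive Rel (Γ : DirectedGraph V E) : FreeWithZero V E → FreeWithZero V E → Prop
  | vertex_mul_self (v : V) : Rel Γ (freeVertex E v * freeVertex E v) (freeVertex E v)
  | vertex_mul_of_ne (u v : V) (h : u ≠ v) : Rel Γ (freeVertex E u * freeVertex E v) 0
  | source_mul_edge (e : E) : Rel Γ (freeVertex E (Γ.s e) * freeEdge V e) (freeEdge V e)
  | edge_mul_range (e : E) : Rel Γ (freeEdge V e * freeVertex E (Γ.r e)) (freeEdge V e)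
  | range_mul_star (e : E) : Rel Γ (freeVertex E (Γ.r e) * freeStar V e) (freeStar V e)
  | star_mul_source (e : E) : Rel Γ (freeStar V e * freeVertex E (Γ.s e)) (freeStar V e)
  | star_mul_edge_self (e : E) : Rel Γ (freeStar V e * freeEdge V e) (freeVertex E (Γ.r e))
  | star_mul_edge_of_ne (f e : E) (h : f ≠ e) : Rel Γ (freeStar V f * freeEdge V e) 0

/-- The graph inverse semigroup `Inv(Γ)`: the semigroup with zero presented by the generators
`Gen V E` and the relations `Rel Γ`. -/
def GraphInverseSemigroup (Γ : DirectedGraph V E) : Type (max u v) :=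
  (conGen (Rel Γ)).Quotient

instance (Γ : DirectedGraph V E) : SemigroupWithZero (GraphInverseSemigroup Γ) where
  toSemigroup := inferInstanceAs (Semigroup (conGen (Rel Γ)).Quotient)
  zero := ((0 : FreeWithZero V E) : (conGen (Rel Γ)).Quotient)
  zero_mul a := by
    induction a using Con.induction_on with
    | H x => exact congrArg (fun y : FreeWithZero V E => (y : (conGen (Rel Γ)).Quotient))
              (zero_mul x)
  mul_zero a := by
    induction a using Con.induction_on with
    | H x => exact congrArg (fun y : FreeWithZero V E => (y : (conGen (Rel Γ)).Quotient))
              (mul_zero x)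

/-- The congruence lattice of `Inv(Γ)`: all congruences of the semigroup, ordered by inclusion. -/
abbrev CongruenceLattice (Γ : DirectedGraph V E) : Type (max u v) :=
  Con (GraphInverseSemigroup Γ)

end GraphInverseSemigroup

section Components

/-- `u` and `v` are the endpoints of an undirected edge of the underlying graph. -/
def UndirectedAdj (Γ : DirectedGraph V E) (u v : V) : Prop :=
  ∃ e : E, (Γ.s e = u ∧ Γ.r e = v) ∨ (Γ.s e = v ∧ Γ.r e = u)

/-- Any two distinct vertices are connected by a nontrivial undirected path. -/
def IsWeaklyConnected (Γ : DirectedGraph V E) : Prop :=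
  ∀ u v : V, u ≠ v → Relation.TransGen Γ.UndirectedAdj u v

/-- A subgraph of `Γ`: a set of vertices and a set of edges containing the endpoints of its
edges. -/
structure Subgraph (Γ : DirectedGraph V E) where
  /-- the vertices of the subgraph -/
  verts : Set V
  /-- the edges of the subgraph -/
  edges : Set E
  s_mem : ∀ e ∈ edges, Γ.s e ∈ verts
  r_mem : ∀ e ∈ edges, Γ.r e ∈ verts

/-- A subgraph regarded as a directed graph, with the restricted source and range functions. -/
def Subgraph.toDirectedGraph {Γ : DirectedGraph V E} (Δ : Γ.Subgraph) :
    DirectedGraph Δ.verts Δ.edges where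
  s e := ⟨Γ.s e, Δ.s_mem e e.2⟩
  r e := ⟨Γ.r e, Δ.r_mem e e.2⟩

/-- Subgraphs are ordered by inclusion of vertices and of edges. -/
instance (Γ : DirectedGraph V E) : LE Γ.Subgraph where
  le Δ₁ Δ₂ := Δ₁.verts ⊆ Δ₂.verts ∧ Δ₁.edges ⊆ Δ₂.edges

/-- A weakly connected component of `Γ` is a maximal weakly connected subgraph. -/
def Subgraph.IsWeaklyConnectedComponent {Γ : DirectedGraph V E} (Δ : Γ.Subgraph) : Prop :=
  Maximal (fun Δ' : Γ.Subgraph => Δ'.toDirectedGraph.IsWeaklyConnected) Δ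

end Components

end DirectedGraph

/-- Distributivity of a lattice. -/
def IsDistributiveLattice (L : Type*) [Lattice L] : Prop :=
  ∀ a b c : L, (a ⊔ b) ⊓ c = (a ⊓ c) ⊔ (b ⊓ c)

/-! `Inv(Γ)` is the orthogonal sum of the semigroups of the weakly connected components: each
nonzero element comes from a component, and elements of different components multiply to zero. Every
element has a left unit in its own component, so a congruence relating elements of two different
components relates both to zero. Congruences on `Inv(Γ)` therefore correspond to families of
congruences on the components (`Con.orthogonalSumIso`, `congruenceLatticeIso`), and a product of
lattices with bottom is distributive exactly when each factor is. -/

section Lattices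

theorem IsDistributiveLattice.of_orderIso {L M : Type*} [Lattice L] [Lattice M] (f : L ≃o M)
    (h : IsDistributiveLattice L) : IsDistributiveLattice M := fun a b c => by
  simpa using congrArg f (h (f.symm a) (f.symm b) (f.symm c))

theorem isDistributiveLattice_pi_iff {I : Type*} {L : I → Type*} [∀ i, CompleteLattice (L i)] :
    IsDistributiveLattice (∀ i, L i) ↔ ∀ i, IsDistributiveLattice (L i) := by
  classical
  refine ⟨fun h i a b c => ?_, fun h a b c => funext fun i => h i (a i) (b i) (c i)⟩
  -- The factor `L i` sits in the product as the families equal to `⊥` away from `i`.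
  simpa using congrFun
    (h (Function.update ⊥ i a) (Function.update ⊥ i b) (Function.update ⊥ i c)) i

end Lattices

/-! ### Congruences on an orthogonal sum -/

section OrthogonalSum

variable {S I : Type*} {T : I → Type*} [SemigroupWithZero S] [∀ i, SemigroupWithZero (T i)]

/-- If a semigroup with zero is the orthogonal sum of semigroups `T i` in which every element has
a left unit, its congruences are the families of congruences on the `T i`. -/
def Con.orthogonalSumIso (inc : ∀ i, T i →ₙ* S) (proj : ∀ i, S →ₙ* T i)
    (inc_zero : ∀ i, inc i 0 = 0) (proj_zero : ∀ i, proj i 0 = 0)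
    (proj_inc : ∀ i a, proj i (inc i a) = a)
    (proj_inc_of_ne : ∀ i j, i ≠ j → ∀ a, proj i (inc j a) = 0)
    (cover : ∀ x, x = 0 ∨ ∃ i a, inc i a = x)
    (orthogonal : ∀ i j, i ≠ j → ∀ a b, inc i a * inc j b = 0)
    (exists_unit : ∀ i (a : T i), ∃ e, e * a = a) :
    Con S ≃o ∀ i, Con (T i) :=
  -- Left multiplication by a left unit of `a` fixes `inc i a` and kills `inc j b`.
  have rel_zero (ρ : Con S) {i j : I} (h : i ≠ j) {a : T i} {b : T j}
      (hab : ρ (inc i a) (inc j b)) : ρ (inc i a) 0 := by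
    obtain ⟨e, he⟩ := exists_unit i a
    have := ρ.mul (ρ.refl (inc i e)) hab
    rwa [← map_mul, he, orthogonal i j h] at this
  have rel_proj (ρ : Con S) {x : S} (hx : ρ x 0) (i : I) : ρ (inc i (proj i x)) 0 := by
    rcases cover x with rfl | ⟨j, a, rfl⟩
    · rw [proj_zero, inc_zero]; exact ρ.refl 0
    · by_cases h : i = j
      · subst h; rwa [proj_inc]
      · rw [proj_inc_of_ne i j h, inc_zero]; exact ρ.refl 0
  have rel_of_proj (ρ : Con S) {x : S} (hx : ∀ i, ρ (inc i (proj i x)) 0) : ρ x 0 := by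
    rcases cover x with rfl | ⟨j, a, rfl⟩
    · exact ρ.refl 0
    · simpa only [proj_inc] using hx j
  { toFun := fun ρ i => Con.comap (inc i) (map_mul (inc i)) ρ
    -- Two elements are related when all their projections are.
    invFun := fun σ => ⨅ i, Con.comap (proj i) (map_mul (proj i)) (σ i)
    left_inv := fun ρ => by
      ext x y
      simp only [Con.coe_iInf, iInf_apply, iInf_Prop_eq, Con.comap_rel]
      rcases cover x with rfl | ⟨i, a, rfl⟩
      · simp only [proj_zero, inc_zero]
        exact ⟨fun h => ρ.symm (rel_of_proj ρ fun i => ρ.symm (h i)),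
          fun h i => ρ.symm (rel_proj ρ (ρ.symm h) i)⟩
      rcases cover y with rfl | ⟨j, b, rfl⟩
      · simp only [proj_zero, inc_zero]
        exact ⟨rel_of_proj ρ, rel_proj ρ⟩
      by_cases hij : i = j
      · subst hij
        refine ⟨fun h => by simpa only [proj_inc] using h i, fun h k => ?_⟩
        by_cases hk : k = i
        · subst hk; simpa only [proj_inc] using h
        · rw [proj_inc_of_ne k i hk, proj_inc_of_ne k i hk]; exact ρ.refl _
      -- Across different components both sides of the equivalence pass through zero.
      · refine ⟨fun h => ?_, fun h k => ?_⟩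
        · have h₁ := h i
          have h₂ := h j
          rw [proj_inc, proj_inc_of_ne i j hij, inc_zero] at h₁
          rw [proj_inc, proj_inc_of_ne j i (Ne.symm hij), inc_zero] at h₂
          exact ρ.trans h₁ h₂
        · exact ρ.trans (rel_proj ρ (rel_zero ρ hij h) k)
            (ρ.symm (rel_proj ρ (rel_zero ρ (Ne.symm hij) (ρ.symm h)) k))
    right_inv := fun σ => by
      funext i
      ext a b
      simp only [Con.coe_iInf, iInf_apply, iInf_Prop_eq, Con.comap_rel]
      refine ⟨fun h => by simpa only [proj_inc] using h i, fun h j => ?_⟩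
      by_cases hj : j = i
      · subst hj; simpa only [proj_inc] using h
      · rw [proj_inc_of_ne j i hj, proj_inc_of_ne j i hj]; exact (σ j).refl _
    map_rel_iff' := fun {ρ σ} => by
      refine ⟨fun h x y hxy => ?_, fun h i a b hab => h hab⟩
      have key {i : I} {a b : T i} (hab : ρ (inc i a) (inc i b)) : σ (inc i a) (inc i b) :=
        h i hab
      have key_zero {x : S} (hx : ρ x 0) : σ x 0 := by
        rcases cover x with rfl | ⟨i, a, rfl⟩
        · exact σ.refl 0
        -- Zero lies in every summand, so a relation to zero is visible in the summand of `x`.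
        · rw [← inc_zero i] at hx ⊢; exact key hx
      rcases cover x with rfl | ⟨i, a, rfl⟩
      · exact σ.symm (key_zero (ρ.symm hxy))
      rcases cover y with rfl | ⟨j, b, rfl⟩
      · exact key_zero hxy
      by_cases hij : i = j
      · subst hij; exact key hxy
      · exact σ.trans (key_zero (rel_zero ρ hij hxy))
          (σ.symm (key_zero (rel_zero ρ (Ne.symm hij) (ρ.symm hxy)))) }

end OrthogonalSum

namespace DirectedGraph

variable {V : Type u} {E : Type v}

/-! ### Generators, universal property and local units -/

namespace GraphInverseSemigroup

/-- The image of a generator in the graph inverse semigroup. -/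
def gen (Γ : DirectedGraph V E) (g : Gen V E) : GraphInverseSemigroup Γ :=
  Con.toQuotient (c := conGen (Rel Γ)) (WithZero.coe (FreeSemigroup.of g))

section Relations

variable (Γ : DirectedGraph V E)

theorem sound {x y : FreeWithZero V E} (h : Rel Γ x y) :
    Con.toQuotient (c := conGen (Rel Γ)) x = Con.toQuotient (c := conGen (Rel Γ)) y :=
  (Con.eq _).2 (ConGen.Rel.of _ _ h)

theorem vertex_mul_self (w : V) : gen Γ (.vertex w) * gen Γ (.vertex w) = gen Γ (.vertex w) :=
  sound Γ (.vertex_mul_self w)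

theorem vertex_mul_of_ne {w w' : V} (h : w ≠ w') :
    gen Γ (.vertex w) * gen Γ (.vertex w') = 0 :=
  sound Γ (.vertex_mul_of_ne w w' h)

theorem source_mul_edge (e : E) : gen Γ (.vertex (Γ.s e)) * gen Γ (.edge e) = gen Γ (.edge e) :=
  sound Γ (.source_mul_edge e)

theorem edge_mul_range (e : E) : gen Γ (.edge e) * gen Γ (.vertex (Γ.r e)) = gen Γ (.edge e) :=
  sound Γ (.edge_mul_range e)

theorem range_mul_star (e : E) : gen Γ (.vertex (Γ.r e)) * gen Γ (.star e) = gen Γ (.star e) :=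
  sound Γ (.range_mul_star e)

theorem star_mul_source (e : E) : gen Γ (.star e) * gen Γ (.vertex (Γ.s e)) = gen Γ (.star e) :=
  sound Γ (.star_mul_source e)

theorem star_mul_edge_self (e : E) :
    gen Γ (.star e) * gen Γ (.edge e) = gen Γ (.vertex (Γ.r e)) :=
  sound Γ (.star_mul_edge_self e)

theorem star_mul_edge_of_ne {f e : E} (h : f ≠ e) : gen Γ (.star f) * gen Γ (.edge e) = 0 :=
  sound Γ (.star_mul_edge_of_ne f e h)

end Relations

theorem induction {Γ : DirectedGraph V E} {P : GraphInverseSemigroup Γ → Prop} (zero : P 0)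
    (of_gen : ∀ g, P (gen Γ g)) (mul : ∀ x y, P x → P y → P (x * y))
    (x : GraphInverseSemigroup Γ) : P x := by
  induction x using Con.induction_on with
  | H x =>
    induction x using WithZero.recZeroCoe with
    | zero => exact zero
    | coe x =>
      induction x using FreeSemigroup.recOnMul with
      | ih1 g => exact of_gen g
      | ih2 g y hg hy => exact mul _ _ hg hy

section Lift

variable {T : Type*} [SemigroupWithZero T]

/-- The extension of a function on generators to the free semigroup with zero. -/
def freeLift (f : Gen V E → T) : FreeWithZero V E →ₙ* T where
  toFun := WithZero.recZeroCoe 0 (FreeSemigroup.lift f)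
  map_mul' x y := by
    induction x using WithZero.recZeroCoe with
    | zero => simp
    | coe x =>
      induction y using WithZero.recZeroCoe with
      | zero => simp
      | coe y => simp [← WithZero.coe_mul]

/-- The homomorphism out of the graph inverse semigroup given by images of the generators. -/
def lift (Γ : DirectedGraph V E) (f : Gen V E → T)
    (h : ∀ x y, Rel Γ x y → freeLift f x = freeLift f y) : GraphInverseSemigroup Γ →ₙ* T where
  toFun x := Con.liftOn x (freeLift f) fun x y hxy => by
    -- The comap of `⊥` is the kernel congruence of `freeLift f`.
    have hle : conGen (Rel Γ) ≤ Con.comap (freeLift f) (map_mul _) ⊥ := Con.conGen_le.2 h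
    exact hle hxy
  map_mul' x y := by
    induction x, y using Con.induction_on₂ with
    | H x y => exact map_mul (freeLift f) x y

end Lift

/-- The defining relations give each generator a vertex as left unit, and a product inherits that of
its first factor. -/
theorem exists_vertex_mul {Γ : DirectedGraph V E} (x : GraphInverseSemigroup Γ) :
    x = 0 ∨ ∃ w, gen Γ (.vertex w) * x = x := by
  induction x using induction with
  | zero => exact .inl rfl
  | of_gen g =>
    cases g with
    | vertex w => exact .inr ⟨w, vertex_mul_self Γ w⟩
    | edge e => exact .inr ⟨_, source_mul_edge Γ e⟩
    | star e => exact .inr ⟨_, range_mul_star Γ e⟩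
  | mul x y hx hy =>
    rcases hx with rfl | ⟨w, hw⟩
    · exact .inl (zero_mul y)
    · exact .inr ⟨w, by rw [← mul_assoc, hw]⟩

theorem exists_mul_vertex {Γ : DirectedGraph V E} (x : GraphInverseSemigroup Γ) :
    x = 0 ∨ ∃ w, x * gen Γ (.vertex w) = x := by
  induction x using induction with
  | zero => exact .inl rfl
  | of_gen g =>
    cases g with
    | vertex w => exact .inr ⟨w, vertex_mul_self Γ w⟩
    | edge e => exact .inr ⟨_, edge_mul_range Γ e⟩
    | star e => exact .inr ⟨_, star_mul_source Γ e⟩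
  | mul x y hx hy =>
    rcases hy with rfl | ⟨w, hw⟩
    · exact .inl (mul_zero x)
    · exact .inr ⟨w, by rw [mul_assoc, hw]⟩

theorem exists_left_unit {Γ : DirectedGraph V E} (x : GraphInverseSemigroup Γ) :
    ∃ e, e * x = x := by
  rcases exists_vertex_mul x with rfl | ⟨w, hw⟩
  · exact ⟨0, zero_mul 0⟩
  · exact ⟨_, hw⟩

end GraphInverseSemigroup

open GraphInverseSemigroup

/-! ### Inclusion of a subgraph and retraction onto a saturated one -/

namespace Subgraph

variable {Γ : DirectedGraph V E} (Δ : Γ.Subgraph)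

/-- The image in `Inv(Γ)` of a generator of the graph inverse semigroup of a subgraph. -/
def genInclusion : Gen Δ.verts Δ.edges → GraphInverseSemigroup Γ
  | .vertex w => gen Γ (.vertex w)
  | .edge e => gen Γ (.edge e)
  | .star e => gen Γ (.star e)

/-- The homomorphism of graph inverse semigroups induced by the inclusion of a subgraph. -/
def inclusion : GraphInverseSemigroup Δ.toDirectedGraph →ₙ* GraphInverseSemigroup Γ :=
  lift _ Δ.genInclusion fun x y h => by
    cases h with
    | vertex_mul_self w => exact vertex_mul_self Γ w
    | vertex_mul_of_ne w w' h => exact vertex_mul_of_ne Γ (Subtype.coe_ne_coe.2 h)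
    | source_mul_edge e => exact source_mul_edge Γ e
    | edge_mul_range e => exact edge_mul_range Γ e
    | range_mul_star e => exact range_mul_star Γ e
    | star_mul_source e => exact star_mul_source Γ e
    | star_mul_edge_self e => exact star_mul_edge_self Γ e
    | star_mul_edge_of_ne f e h => exact star_mul_edge_of_ne Γ (Subtype.coe_ne_coe.2 h)

/-- A subgraph is saturated if it contains every edge with an endpoint in it. -/
def IsSaturated : Prop :=
  ∀ e, (Γ.s e ∈ Δ.verts → e ∈ Δ.edges) ∧ (Γ.r e ∈ Δ.verts → e ∈ Δ.edges)

open Classical in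
/-- The generators of the subgraph are kept, all others are sent to zero. -/
noncomputable def genProjection : Gen V E → GraphInverseSemigroup Δ.toDirectedGraph
  | .vertex w => if h : w ∈ Δ.verts then gen _ (.vertex ⟨w, h⟩) else 0
  | .edge e => if h : e ∈ Δ.edges then gen _ (.edge ⟨e, h⟩) else 0
  | .star e => if h : e ∈ Δ.edges then gen _ (.star ⟨e, h⟩) else 0

/-- Saturation matters only for `e* e = r(e)`: if `e` is discarded, `r(e)` must go to zero too. The
other relations need only that a subgraph contains the endpoints of its edges. -/
theorem genProjection_respects (hΔ : Δ.IsSaturated) (x y : FreeWithZero V E) (h : Rel Γ x y) :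
    freeLift Δ.genProjection x = freeLift Δ.genProjection y := by
  have map_gen (g) : freeLift Δ.genProjection (WithZero.coe (FreeSemigroup.of g)) =
    Δ.genProjection g := rfl
  have map_zero : freeLift Δ.genProjection 0 = 0 := rfl
  cases h with
  | vertex_mul_self w =>
    simp only [map_mul, freeVertex, map_gen, genProjection]
    split_ifs with hw
    · exact vertex_mul_self _ _
    · exact zero_mul _
  | vertex_mul_of_ne w w' hne =>
    simp only [map_mul, freeVertex, map_gen, map_zero, genProjection]
    split_ifs with hw hw'
    · exact vertex_mul_of_ne _ fun h => hne (congrArg Subtype.val h)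
    all_goals simp
  | source_mul_edge e =>
    simp only [map_mul, freeVertex, freeEdge, map_gen, genProjection]
    by_cases he : e ∈ Δ.edges
    · rw [dif_pos he, dif_pos (Δ.s_mem e he)]
      exact source_mul_edge Δ.toDirectedGraph ⟨e, he⟩
    · rw [dif_neg he, mul_zero]
  | edge_mul_range e =>
    simp only [map_mul, freeVertex, freeEdge, map_gen, genProjection]
    by_cases he : e ∈ Δ.edges
    · rw [dif_pos he, dif_pos (Δ.r_mem e he)]
      exact edge_mul_range Δ.toDirectedGraph ⟨e, he⟩
    · rw [dif_neg he, zero_mul]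
  | range_mul_star e =>
    simp only [map_mul, freeVertex, freeStar, map_gen, genProjection]
    by_cases he : e ∈ Δ.edges
    · rw [dif_pos he, dif_pos (Δ.r_mem e he)]
      exact range_mul_star Δ.toDirectedGraph ⟨e, he⟩
    · rw [dif_neg he, mul_zero]
  | star_mul_source e =>
    simp only [map_mul, freeVertex, freeStar, map_gen, genProjection]
    by_cases he : e ∈ Δ.edges
    · rw [dif_pos he, dif_pos (Δ.s_mem e he)]
      exact star_mul_source Δ.toDirectedGraph ⟨e, he⟩
    · rw [dif_neg he, zero_mul]
  | star_mul_edge_self e =>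
    simp only [map_mul, freeVertex, freeEdge, freeStar, map_gen, genProjection]
    by_cases he : e ∈ Δ.edges
    · rw [dif_pos he, dif_pos he, dif_pos (Δ.r_mem e he)]
      exact star_mul_edge_self Δ.toDirectedGraph ⟨e, he⟩
    · rw [dif_neg he, dif_neg he, dif_neg fun hr => he ((hΔ e).2 hr), zero_mul]
  | star_mul_edge_of_ne f e hne =>
    simp only [map_mul, freeEdge, freeStar, map_gen, map_zero, genProjection]
    split_ifs with hf he
    · exact star_mul_edge_of_ne _ fun h => hne (congrArg Subtype.val h)
    all_goals simp

/-- The retraction of `Inv(Γ)` onto the graph inverse semigroup of a saturated subgraph. -/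
noncomputable def projection (hΔ : Δ.IsSaturated) :
    GraphInverseSemigroup Γ →ₙ* GraphInverseSemigroup Δ.toDirectedGraph :=
  lift _ Δ.genProjection (Δ.genProjection_respects hΔ)

theorem inclusion_zero : Δ.inclusion 0 = 0 := rfl

theorem projection_zero (hΔ : Δ.IsSaturated) : Δ.projection hΔ 0 = 0 := rfl

theorem projection_inclusion (hΔ : Δ.IsSaturated) (x : GraphInverseSemigroup Δ.toDirectedGraph) :
    Δ.projection hΔ (Δ.inclusion x) = x := by
  induction x using GraphInverseSemigroup.induction with
  | zero => rfl
  | of_gen g =>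
    cases g with
    | vertex w => exact dif_pos w.2
    | edge e => exact dif_pos e.2
    | star e => exact dif_pos e.2
  | mul x y hx hy => rw [map_mul, map_mul, hx, hy]

theorem projection_vertex_of_notMem (hΔ : Δ.IsSaturated) {w : V} (hw : w ∉ Δ.verts) :
    Δ.projection hΔ (gen Γ (.vertex w)) = 0 :=
  dif_neg hw

theorem inclusion_vertex (w : Δ.verts) :
    Δ.inclusion (gen _ (.vertex w)) = gen Γ (.vertex w) := rfl

variable {Δ}

theorem projection_inclusion_of_disjoint (hΔ : Δ.IsSaturated) {Δ' : Γ.Subgraph}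
    (h : Disjoint Δ.verts Δ'.verts) (x : GraphInverseSemigroup Δ'.toDirectedGraph) :
    Δ.projection hΔ (Δ'.inclusion x) = 0 := by
  rcases exists_vertex_mul x with rfl | ⟨w, hw⟩
  · rfl
  · rw [← hw, map_mul, map_mul, inclusion_vertex,
      projection_vertex_of_notMem _ _ (Set.disjoint_right.1 h w.2), zero_mul]

/-- Inserting a right unit of `x` and a left unit of `y` puts two distinct vertices side by side. -/
theorem inclusion_mul_inclusion_of_disjoint {Δ' : Γ.Subgraph} (h : Disjoint Δ.verts Δ'.verts)
    (x : GraphInverseSemigroup Δ.toDirectedGraph)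
    (y : GraphInverseSemigroup Δ'.toDirectedGraph) : Δ.inclusion x * Δ'.inclusion y = 0 := by
  rcases exists_mul_vertex x with rfl | ⟨w, hw⟩
  · rw [inclusion_zero, zero_mul]
  rcases exists_vertex_mul y with rfl | ⟨w', hw'⟩
  · rw [inclusion_zero, mul_zero]
  rw [← hw, ← hw', map_mul, map_mul, mul_assoc, ← mul_assoc (Δ.inclusion (gen _ _)),
    inclusion_vertex, inclusion_vertex, vertex_mul_of_ne Γ (h.ne_of_mem w.2 w'.2), zero_mul,
    mul_zero]

end Subgraph

/-! ### Weakly connected components and the decomposition -/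

section Components

variable (Γ : DirectedGraph V E)

theorem undirectedAdj_symm {w w' : V} (h : Γ.UndirectedAdj w w') : Γ.UndirectedAdj w' w :=
  h.imp fun _ => Or.symm

/-- The subgraph spanned by the vertices joined to `w` by an undirected path. -/
def componentOf (w : V) : Γ.Subgraph where
  verts := {w' | Relation.ReflTransGen Γ.UndirectedAdj w w'}
  edges := {e | Relation.ReflTransGen Γ.UndirectedAdj w (Γ.s e)}
  s_mem _ he := he
  r_mem e he := he.tail ⟨e, .inl ⟨rfl, rfl⟩⟩

theorem mem_componentOf (w : V) : w ∈ (Γ.componentOf w).verts := .refl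

theorem isSaturated_componentOf (w : V) : (Γ.componentOf w).IsSaturated := fun e =>
  ⟨fun h => h, fun h => Relation.ReflTransGen.tail h ⟨e, .inr ⟨rfl, rfl⟩⟩⟩

/-- A path of `Γ` starting at `w` never leaves the component, since saturation puts each of its
edges there. -/
theorem reflTransGen_componentOf {w w' : V} (h : w' ∈ (Γ.componentOf w).verts) :
    Relation.ReflTransGen (Γ.componentOf w).toDirectedGraph.UndirectedAdj
      ⟨w, Γ.mem_componentOf w⟩ ⟨w', h⟩ := by
  have h' : Relation.ReflTransGen Γ.UndirectedAdj w w' := h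
  induction h' with
  | refl => exact .refl
  | @tail b c hb hbc ih =>
    refine (ih hb).tail ?_
    obtain ⟨e, he⟩ := hbc
    have hmem : e ∈ (Γ.componentOf w).edges := by
      rcases he with ⟨rfl, -⟩ | ⟨-, rfl⟩
      · exact hb
      · exact (Γ.isSaturated_componentOf w e).2 hb
    exact ⟨⟨e, hmem⟩, he.imp (fun h => ⟨Subtype.ext h.1, Subtype.ext h.2⟩)
      fun h => ⟨Subtype.ext h.1, Subtype.ext h.2⟩⟩

theorem isWeaklyConnected_componentOf (w : V) :
    (Γ.componentOf w).toDirectedGraph.IsWeaklyConnected := fun a b hab => by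
  have : Std.Symm (Γ.componentOf w).toDirectedGraph.UndirectedAdj :=
    ⟨fun _ _ => undirectedAdj_symm _⟩
  have h := (Relation.ReflTransGen.stdSymm.symm _ _ (Γ.reflTransGen_componentOf a.2)).trans (Γ.reflTransGen_componentOf b.2)
  exact (Relation.reflTransGen_iff_eq_or_transGen.1 h).resolve_left (Ne.symm hab)

variable {Γ}

theorem Subgraph.le_componentOf {Δ : Γ.Subgraph} (hΔ : Δ.toDirectedGraph.IsWeaklyConnected)
    {w : V} (hw : w ∈ Δ.verts) : Δ ≤ Γ.componentOf w := by
  have hverts : Δ.verts ⊆ (Γ.componentOf w).verts := fun w' hw' => by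
    by_cases h : w = w'
    · subst h; exact Γ.mem_componentOf w
    · refine (hΔ ⟨w, hw⟩ ⟨w', hw'⟩ fun h' => h (congrArg Subtype.val h')).to_reflTransGen.lift
        Subtype.val ?_
      rintro a b ⟨e, he⟩
      exact ⟨e, he.imp (fun h => ⟨congrArg Subtype.val h.1, congrArg Subtype.val h.2⟩)
        fun h => ⟨congrArg Subtype.val h.1, congrArg Subtype.val h.2⟩⟩
  exact ⟨hverts, fun e he => hverts (Δ.s_mem e he)⟩

theorem Subgraph.le_antisymm {Δ Δ' : Γ.Subgraph} (h : Δ ≤ Δ') (h' : Δ' ≤ Δ) : Δ = Δ' := by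
  cases Δ
  cases Δ'
  congr
  · exact h.1.antisymm h'.1
  · exact h.2.antisymm h'.2

/-- Maximality applies because `Γ.componentOf w` is weakly connected and contains `Δ`. Saturation
and disjointness of components follow from this. -/
theorem Subgraph.IsWeaklyConnectedComponent.eq_componentOf {Δ : Γ.Subgraph}
    (hΔ : Δ.IsWeaklyConnectedComponent) {w : V} (hw : w ∈ Δ.verts) : Δ = Γ.componentOf w :=
  have h := Subgraph.le_componentOf hΔ.prop hw
  Subgraph.le_antisymm h (hΔ.2 (Γ.isWeaklyConnected_componentOf w) h)

variable (Γ) in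
theorem isWeaklyConnectedComponent_componentOf (w : V) :
    (Γ.componentOf w).IsWeaklyConnectedComponent :=
  ⟨Γ.isWeaklyConnected_componentOf w,
    fun _ hΔ h => Subgraph.le_componentOf hΔ (h.1 (Γ.mem_componentOf w))⟩

theorem Subgraph.IsWeaklyConnectedComponent.isSaturated {Δ : Γ.Subgraph}
    (hΔ : Δ.IsWeaklyConnectedComponent) : Δ.IsSaturated := fun e =>
  ⟨fun h => by
    have := (Γ.isSaturated_componentOf (Γ.s e) e).1 (Γ.mem_componentOf _)
    rwa [← hΔ.eq_componentOf h] at this,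
  fun h => by
    have := (Γ.isSaturated_componentOf (Γ.r e) e).2 (Γ.mem_componentOf _)
    rwa [← hΔ.eq_componentOf h] at this⟩

theorem Subgraph.IsWeaklyConnectedComponent.disjoint {Δ Δ' : Γ.Subgraph}
    (hΔ : Δ.IsWeaklyConnectedComponent) (hΔ' : Δ'.IsWeaklyConnectedComponent) (h : Δ ≠ Δ') :
    Disjoint Δ.verts Δ'.verts :=
  Set.disjoint_left.2 fun _ hw hw' => h ((hΔ.eq_componentOf hw).trans (hΔ'.eq_componentOf hw').symm)

/-- Each generator lies in one component; a product stays in the common component of its factors or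
vanishes. -/
theorem exists_inclusion_eq (x : GraphInverseSemigroup Γ) :
    x = 0 ∨ ∃ (Δ : {Δ : Γ.Subgraph // Δ.IsWeaklyConnectedComponent})
      (a : GraphInverseSemigroup Δ.1.toDirectedGraph), Δ.1.inclusion a = x := by
  induction x using GraphInverseSemigroup.induction with
  | zero => exact .inl rfl
  | of_gen g =>
    right
    cases g with
    | vertex w =>
      exact ⟨⟨_, Γ.isWeaklyConnectedComponent_componentOf w⟩,
        gen _ (.vertex ⟨w, Γ.mem_componentOf w⟩), rfl⟩
    | edge e =>
      exact ⟨⟨_, Γ.isWeaklyConnectedComponent_componentOf (Γ.s e)⟩,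
        gen _ (.edge ⟨e, Γ.mem_componentOf (Γ.s e)⟩), rfl⟩
    | star e =>
      exact ⟨⟨_, Γ.isWeaklyConnectedComponent_componentOf (Γ.s e)⟩,
        gen _ (.star ⟨e, Γ.mem_componentOf (Γ.s e)⟩), rfl⟩
  | mul x y hx hy =>
    rcases hx with rfl | ⟨Δ, a, rfl⟩
    · exact .inl (zero_mul y)
    rcases hy with rfl | ⟨Δ', b, rfl⟩
    · exact .inl (mul_zero _)
    by_cases h : Δ = Δ'
    · subst h
      exact .inr ⟨Δ, a * b, map_mul _ a b⟩
    · exact .inl (Subgraph.inclusion_mul_inclusion_of_disjoint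
        (Δ.2.disjoint Δ'.2 (Subtype.coe_ne_coe.2 h)) a b)

variable (Γ) in
/-- The congruence lattice of `Inv(Γ)` is the product of the congruence lattices of the weakly
connected components. -/
noncomputable def congruenceLatticeIso :
    Γ.CongruenceLattice ≃o ∀ Δ : {Δ : Γ.Subgraph // Δ.IsWeaklyConnectedComponent},
      Δ.1.toDirectedGraph.CongruenceLattice :=
  Con.orthogonalSumIso (fun Δ => Δ.1.inclusion) (fun Δ => Δ.1.projection Δ.2.isSaturated)
    (fun Δ => Δ.1.inclusion_zero) (fun Δ => Δ.1.projection_zero _)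
    (fun Δ => Δ.1.projection_inclusion _)
    (fun Δ Δ' h => Subgraph.projection_inclusion_of_disjoint _
      (Δ.2.disjoint Δ'.2 (Subtype.coe_ne_coe.2 h)))
    exists_inclusion_eq
    (fun Δ Δ' h => Subgraph.inclusion_mul_inclusion_of_disjoint
      (Δ.2.disjoint Δ'.2 (Subtype.coe_ne_coe.2 h)))
    (fun _ => exists_left_unit)

end Components

end DirectedGraph

theorem mainTheorem6 {V : Type u} {E : Type v} (Γ : DirectedGraph V E) :
    IsDistributiveLattice Γ.CongruenceLattice ↔
      ∀ Δ : Γ.Subgraph, Δ.IsWeaklyConnectedComponent →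
        IsDistributiveLattice Δ.toDirectedGraph.CongruenceLattice := by
  rw [← Subtype.forall (p := DirectedGraph.Subgraph.IsWeaklyConnectedComponent)
    (q := fun Δ => IsDistributiveLattice Δ.1.toDirectedGraph.CongruenceLattice),
    ← isDistributiveLattice_pi_iff]
  exact ⟨.of_orderIso Γ.congruenceLatticeIso, .of_orderIso Γ.congruenceLatticeIso.symm⟩
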